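/- Let $d\in\mathbb N$ and $\Omega=\{-1,1\}^{\mathbb Z^d}$ with the product topology and its Borel $\sigma$-field. For $\sigma\in\Omega$ and $i\in\mathbb Z^d$ let $\sigma^i$ be $\sigma$ with the spin at $i$ flipped. For continuous $f:\Omega\to\mathbb R$ put $\delta_i f=\sup_{\sigma}\big(f(\sigma^i)-f(\sigma)\big)$ and $\|\delta f\|_2=\big(\sum_{i}(\delta_i f)^2\big)^{1/2}\in[0,\infty]$. A probability measure $\mu$ on $\Omega$ satisfies the uniform variance bound with constant $C$ if $$\int \Big(f-\int f\,d\mu\Big)^2 d\mu\le C\,\|\delta f\|_2^2$$ for all continuous $f:\Omega\to\mathbb R$ with $\|\delta f\|_2<\infty$. Let $c(i,\cdot):\Omega\to(0,\infty)$, $i\in\mathbb Z^d$, be continuous, uniformly bounded flip rates satisfying Condition A: 1. $\inf_{i,\sigma}c(i,\sigma)>0$; 2. $\sup_{i}\sum_{j}\Gamma_{ij}<\infty$, where $\Gamma_{ij}=\sup_{\sigma}\big(c(i,\sigma^j)-c(i,\sigma)\big)$. Assume moreover that the matrix $\Gamma=(\Gamma_{ij})_{i,j\in\mathbb Z^d}$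 acts as a bounded operator on $\ell^2(\mathbb Z^d)$. Let $(S(t))_{t\ge 0}$ be the Feller semigroup on $C(\Omega)$ whose generator is the closure (in the supremum norm) of $$Lf(\sigma)=\sum_{i\in\mathbb Z^d}c(i,\sigma)\big(f(\sigma^i)-f(\sigma)\big),\qquad f \text{ depending on finitely many coordinates},$$ and for a probability measure $\mu$ let $\mu S(t)$ be the probability measure with $\int f\,d(\mu S(t))=\int S(t)f\,d\mu$ for all continuous $f$. If $\mu$ satisfies the uniform variance bound with some constant, then for every $t>0$ there is a constant $C_t\in(0,\infty)$ such that $\mu S(t)$ satisfies the uniform variance bound with constant $C_t$. -/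

import Mathlib

open Filter Topology MeasureTheory
open scoped NNReal

noncomputable section

namespace SpinFlip

/-! ### Configurations, local functions, discrete gradients -/

/-- The lattice `ℤ^d`. -/
abbrev Site (d : ℕ) : Type := Fin d → ℤ

/-- Ising configurations `Ω = {-1, 1}^{ℤ^d}` (`ℤˣ = {-1, 1}`), with the product topology and the
product σ-field (which is the Borel σ-field, see the instances below). -/
abbrev Config (d : ℕ) : Type := Site d → ℤˣ

instance instDiscreteMeasurableSpaceSpin : DiscreteMeasurableSpace ℤˣ where
  forall_measurableSet s :=
    ⟨Units.val '' s, MeasurableSet.of_discrete, Set.preimage_image_eq s Units.val_injective⟩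

instance instBorelSpaceSpin : BorelSpace ℤˣ where
  measurable_eq := by
    rw [borel_eq_top_of_discrete]
    exact eq_top_iff.2 fun s _ => MeasurableSet.of_discrete

/-- `σ^i`: the configuration `σ` with the spin at site `i` flipped. -/
def flip {d : ℕ} (i : Site d) (σ : Config d) : Config d := Function.update σ i (-σ i)

/-- A function on configurations is local if it depends on finitely many coordinates only. -/
def IsLocal {d : ℕ} (f : C(Config d, ℝ)) : Prop :=
  ∃ Λ : Finset (Site d), ∀ σ η : Config d, (∀ i ∈ Λ, σ i = η i) → f σ = f η

/-- `δ_i f = sup_σ (f(σ^i) - f(σ))`.  The supremum is finite because `f` is continuous on a compact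
space. -/
def osc {d : ℕ} (f : C(Config d, ℝ)) (i : Site d) : ℝ :=
  ⨆ σ : Config d, (f (flip i σ) - f σ)

/-- `‖δ f‖₂² < ∞`. -/
def FiniteGradNorm {d : ℕ} (f : C(Config d, ℝ)) : Prop :=
  Summable fun i : Site d => osc f i ^ 2

/-- `‖δ f‖₂ = (∑_i (δ_i f)²)^{1/2}` (meaningful when `FiniteGradNorm f`). -/
def gradNorm {d : ℕ} (f : C(Config d, ℝ)) : ℝ :=
  Real.sqrt (∑' i : Site d, osc f i ^ 2)

/-- The uniform variance bound with constant `C`: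
`E_μ[(f - E_μ f)²] ≤ C ‖δ f‖₂²` for all continuous `f`; the inequality carries no information when
`‖δ f‖₂ = ∞`. -/
def UniformVarianceBound {d : ℕ} (μ : Measure (Config d)) (C : ℝ) : Prop :=
  ∀ f : C(Config d, ℝ), FiniteGradNorm f →
    ∫ σ, (f σ - ∫ η, f η ∂μ) ^ 2 ∂μ ≤ C * gradNorm f ^ 2

/-! ### Markov semigroups on `C(X)` and their generators -/

/-- A (conservative) Feller semigroup on `C(X, ℝ)`: a strongly continuous semigroup of positive
operators preserving constants. -/
structure FellerSemigroup (X : Type*) [TopologicalSpace X] [CompactSpace X] where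
  /-- the operator `S(t)` -/
  op : ℝ≥0 → C(X, ℝ) →L[ℝ] C(X, ℝ)
  op_zero : ∀ f, op 0 f = f
  op_add : ∀ s t f, op (s + t) f = op s (op t f)
  op_one : ∀ t, op t 1 = 1
  op_nonneg : ∀ t f, 0 ≤ f → 0 ≤ op t f
  continuous_op : ∀ f, Continuous fun t => op t f

namespace FellerSemigroup

variable {X : Type*} [TopologicalSpace X] [CompactSpace X]

/-- The graph of the infinitesimal generator: all `(f, g)` such that
`(S(t) f - f) / t → g` uniformly as `t ↓ 0`. -/
def generatorGraph (S : FellerSemigroup X) : Set (C(X, ℝ) × C(X, ℝ)) :=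
  {p | Tendsto (fun t : ℝ≥0 => (t : ℝ)⁻¹ • (S.op t p.1 - p.1)) (𝓝[>] 0) (𝓝 p.2)}

variable [T2Space X] [MeasurableSpace X] [BorelSpace X]

theorem integrable_continuousMap (μ : Measure X) [IsProbabilityMeasure μ] (f : C(X, ℝ)) :
    Integrable (fun x => f x) μ :=
  f.continuous.integrable_of_hasCompactSupport (HasCompactSupport.of_compactSpace _)

/-- The positive linear functional `f ↦ ∫ S(t) f dμ`. -/
def evolveFunctional (S : FellerSemigroup X) (t : ℝ≥0) (μ : Measure X) [IsProbabilityMeasure μ] :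
    CompactlySupportedContinuousMap X ℝ →ₚ[ℝ] ℝ where
  toFun f := ∫ x, S.op t f.toContinuousMap x ∂μ
  map_add' f g := by
    have h : (f + g).toContinuousMap = f.toContinuousMap + g.toContinuousMap := rfl
    rw [h, map_add, ← integral_add (integrable_continuousMap _ _)
      (integrable_continuousMap _ _)]
    rfl
  map_smul' a f := by
    have h : (a • f).toContinuousMap = a • f.toContinuousMap := rfl
    rw [h, map_smul, RingHom.id_apply, ← integral_smul]
    rfl
  monotone' f g hfg := by
    refine integral_mono (integrable_continuousMap _ _)
      (integrable_continuousMap _ _) fun x => ?_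
    have h := S.op_nonneg t (g.toContinuousMap - f.toContinuousMap)
      (fun y => sub_nonneg.2 (hfg y)) x
    rw [map_sub] at h
    exact sub_nonneg.1 h

/-- The time-evolved measure `μ S(t)`: the measure determined by
`∫ f d(μ S(t)) = ∫ S(t) f dμ` for all continuous `f` (see `integral_evolve`). -/
def evolve (S : FellerSemigroup X) (t : ℝ≥0) (μ : Measure X) [IsProbabilityMeasure μ] :
    Measure X :=
  RealRMK.rieszMeasure (S.evolveFunctional t μ)

theorem integral_evolve (S : FellerSemigroup X) (t : ℝ≥0) (μ : Measure X) [IsProbabilityMeasure μ]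
    (f : C(X, ℝ)) : ∫ x, f x ∂(S.evolve t μ) = ∫ x, S.op t f x ∂μ :=
  RealRMK.integral_rieszMeasure (S.evolveFunctional t μ)
    ⟨f, HasCompactSupport.of_compactSpace f⟩

instance isProbabilityMeasure_evolve (S : FellerSemigroup X) (t : ℝ≥0) (μ : Measure X)
    [IsProbabilityMeasure μ] : IsProbabilityMeasure (S.evolve t μ) := by
  have : IsFiniteMeasure (S.evolve t μ) :=
    inferInstanceAs (IsFiniteMeasure (RealRMK.rieszMeasure (S.evolveFunctional t μ)))
  have h := S.integral_evolve t μ 1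
  rw [S.op_one] at h
  simp only [ContinuousMap.one_apply, integral_const, smul_eq_mul, mul_one,
    probReal_univ] at h
  exact ⟨(ENNReal.toReal_eq_one_iff _).1 h⟩

end FellerSemigroup

/-! ### Spin-flip dynamics -/

/-- `Γ_{ij} = sup_σ (c(i, σ^j) - c(i, σ))`. -/
def dependence {d : ℕ} (c : Site d → C(Config d, ℝ)) (i j : Site d) : ℝ := osc (c i) j

/-- Condition A on the flip rates: strict positivity and locality. -/
structure ConditionA {d : ℕ} (c : Site d → C(Config d, ℝ)) : Prop where
  positive : ∃ ε : ℝ, 0 < ε ∧ ∀ i σ, ε ≤ c i σ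
  locality : ∃ M : ℝ, ∀ i, Summable (dependence c i) ∧ ∑' j, dependence c i j ≤ M

/-- The flip rates are uniformly bounded. -/
def BoundedRates {d : ℕ} (c : Site d → C(Config d, ℝ)) : Prop :=
  ∃ K : ℝ, ∀ i σ, c i σ ≤ K

/-- The matrix `Γ` acts as a bounded operator on `ℓ²(ℤ^d)`. -/
def DependenceBoundedL2 {d : ℕ} (c : Site d → C(Config d, ℝ)) : Prop :=
  ∃ T : lp (fun _ : Site d => ℝ) 2 →L[ℝ] lp (fun _ : Site d => ℝ) 2,
    ∀ v i, HasSum (fun j => dependence c i j * v j) (T v i)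

/-- The graph of the pre-generator `L f(σ) = ∑_i c(i, σ) (f(σ^i) - f(σ))`, `f` local (the sum has
finitely many nonzero terms). -/
def pregeneratorGraph {d : ℕ} (c : Site d → C(Config d, ℝ)) :
    Set (C(Config d, ℝ) × C(Config d, ℝ)) :=
  {p | IsLocal p.1 ∧ ∀ σ, p.2 σ = ∑' i, c i σ * (p.1 (flip i σ) - p.1 σ)}

/-- `S` is the semigroup of the spin-flip dynamics with rates `c`: its generator is the closure
(in `C(Ω)` with the supremum norm) of the pre-generator on local functions. -/
def IsSpinFlipSemigroup {d : ℕ} (c : Site d → C(Config d, ℝ)) (S : FellerSemigroup (Config d)) :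
    Prop :=
  S.generatorGraph = closure (pregeneratorGraph c)

end SpinFlip

end

noncomputable section

namespace SpinFlip

variable {d : ℕ}

/-! With `K` bounding the rates, the variance of `f` under `μ S(t)` splits into the `μ`-variance of
`S(t) f` plus `∫ (S(t)(f²) - (S(t) f)²) dμ`. Both terms are controlled by one fact: oscillations
propagate linearly. If `T` is the transpose of `Γ`, then `δ(S(t) f) ≤ exp(tT) δf` coordinatewise,
and `T` is bounded on `ℓ²` because `Γ` is. The hypothesis on `μ` then bounds the first term by `C
‖exp(tT)‖² ‖δf‖₂²`. For the second, interpolating `s ↦ S(s)((S(t-s) f)²)` produces the carré du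
champ `∑ c_i (∇_i S(t-s) f)²`, at most `K ‖exp(tT)‖² ‖δf‖₂²`. Altogether `C_t = (Kt + C) ‖exp(tT)‖²`
works.

The estimates are proved for finite-volume generators, which are bounded, so that their semigroups
are power series (`osc_flow_le`, `flow_sq_sub_sq_flow_le`). The bounds do not depend on the volume.
`tendsto_flow` carries them to `S` for local functions: the row-sum bound on `Γ` makes `T` bounded
on `ℓ¹`, so the flips neglected outside `Λ` form a vanishing tail. Truncation then reaches all
continuous `f` with finite gradient norm (`semigroup_estimates`). -/

theorem flip_apply (i j : Site d) (σ : Config d) :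
    flip i σ j = if j = i then -σ i else σ j := by
  unfold flip
  by_cases h : j = i
  · subst h; simp
  · simp [h]

theorem flip_flip (i : Site d) (σ : Config d) : flip i (flip i σ) = σ := by
  funext j
  simp only [flip_apply]
  by_cases h : j = i <;> simp [h]

theorem flip_comm (i j : Site d) (σ : Config d) : flip i (flip j σ) = flip j (flip i σ) := by
  funext k
  simp only [flip_apply]
  by_cases hi : k = i <;> by_cases hj : k = j <;> by_cases hij : i = j <;> simp_all

theorem continuous_flip (i : Site d) : Continuous (flip i : Config d → Config d) :=
  continuous_id.update i (continuous_apply i).neg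

/-! ### Oscillations -/

theorem bddAbove_flip_sub (f : C(Config d, ℝ)) (i : Site d) :
    BddAbove (Set.range fun σ => f (flip i σ) - f σ) := by
  refine ⟨‖f‖ + ‖f‖, ?_⟩
  rintro _ ⟨σ, rfl⟩
  have h1 := abs_le.1 (f.norm_coe_le_norm (flip i σ))
  have h2 := abs_le.1 (f.norm_coe_le_norm σ)
  dsimp only
  linarith [h1.2, h2.1]

theorem flip_sub_le_osc (f : C(Config d, ℝ)) (i : Site d) (σ : Config d) :
    f (flip i σ) - f σ ≤ osc f i :=
  le_ciSup (bddAbove_flip_sub f i) σ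

/-- Flipping is an involution, so the one-sided supremum is also two-sided. -/
theorem abs_flip_sub_le_osc (f : C(Config d, ℝ)) (i : Site d) (σ : Config d) :
    |f (flip i σ) - f σ| ≤ osc f i := by
  refine abs_le.2 ⟨?_, flip_sub_le_osc f i σ⟩
  have h := flip_sub_le_osc f i (flip i σ)
  rw [flip_flip] at h
  linarith

theorem osc_nonneg (f : C(Config d, ℝ)) (i : Site d) : 0 ≤ osc f i :=
  (abs_nonneg _).trans (abs_flip_sub_le_osc f i 1)

theorem osc_le {f : C(Config d, ℝ)} {i : Site d} {a : ℝ}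
    (h : ∀ σ, f (flip i σ) - f σ ≤ a) : osc f i ≤ a :=
  ciSup_le h

theorem continuous_osc (i : Site d) : Continuous fun f : C(Config d, ℝ) => osc f i := by
  have key : ∀ f g : C(Config d, ℝ), osc f i ≤ osc g i + 2 * ‖f - g‖ := fun f g => osc_le fun σ => by
    have h1 := abs_le.1 ((f - g).norm_coe_le_norm (flip i σ))
    have h2 := abs_le.1 ((f - g).norm_coe_le_norm σ)
    have h3 := flip_sub_le_osc g i σ
    simp only [ContinuousMap.sub_apply] at h1 h2
    linarith [h1.2, h2.1]
  refine (LipschitzWith.of_dist_le_mul (K := 2) fun f g => ?_).continuous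
  rw [Real.dist_eq, dist_eq_norm, abs_le]
  have h1 := key f g
  have h2 := key g f
  rw [norm_sub_rev] at h2
  norm_num
  constructor <;> linarith

/-! ### Discrete gradients and finite-volume generators -/

/-- The discrete gradient `∇_i f(σ) = f(σ^i) - f(σ)` as a bounded operator. -/
def grad (i : Site d) : C(Config d, ℝ) →L[ℝ] C(Config d, ℝ) :=
  LinearMap.mkContinuous
    { toFun := fun f => f.comp ⟨flip i, continuous_flip i⟩ - f
      map_add' := fun f g => by ext σ; simp; ring
      map_smul' := fun a f => by ext σ; simp; ring } 2 fun f => by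
    refine (norm_sub_le _ _).trans ?_
    have : ‖f.comp ⟨flip i, continuous_flip i⟩‖ ≤ ‖f‖ :=
      (ContinuousMap.norm_le _ (norm_nonneg _)).2 fun σ => f.norm_coe_le_norm _
    change ‖f.comp ⟨flip i, continuous_flip i⟩‖ + ‖f‖ ≤ _
    linarith

theorem grad_apply (i : Site d) (f : C(Config d, ℝ)) (σ : Config d) :
    grad i f σ = f (flip i σ) - f σ := rfl

theorem norm_grad_le_osc (i : Site d) (f : C(Config d, ℝ)) : ‖grad i f‖ ≤ osc f i :=
  (ContinuousMap.norm_le _ (osc_nonneg f i)).2 fun σ => abs_flip_sub_le_osc f i σ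

/-- The generator of the dynamics in which only the spins in `Λ` are flipped. -/
def finGen (c : Site d → C(Config d, ℝ)) (Λ : Finset (Site d)) :
    C(Config d, ℝ) →L[ℝ] C(Config d, ℝ) :=
  ∑ i ∈ Λ, (ContinuousLinearMap.mul ℝ C(Config d, ℝ) (c i)).comp (grad i)

theorem finGen_eq_sum (c : Site d → C(Config d, ℝ)) (Λ : Finset (Site d)) (f : C(Config d, ℝ)) :
    finGen c Λ f = ∑ i ∈ Λ, c i * grad i f := by
  simp [finGen]

theorem finGen_apply (c : Site d → C(Config d, ℝ)) (Λ : Finset (Site d)) (f : C(Config d, ℝ))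
    (σ : Config d) : finGen c Λ f σ = ∑ i ∈ Λ, c i σ * (f (flip i σ) - f σ) := by
  simp [finGen_eq_sum, grad_apply]

theorem sum_rates_le {c : Site d → C(Config d, ℝ)} {K : ℝ} (hK : ∀ i σ, c i σ ≤ K)
    (Λ : Finset (Site d)) (σ : Config d) : ∑ i ∈ Λ, c i σ ≤ K * Λ.card := by
  refine (Finset.sum_le_sum fun i _ => hK i σ).trans ?_
  simp [mul_comm]

/-- The shift `K |Λ|` dominates the total flip rate in `Λ`, which makes up for the loss term on the
diagonal. -/
theorem finGen_add_smul_nonneg {c : Site d → C(Config d, ℝ)} {K : ℝ} (hc : ∀ i σ, 0 ≤ c i σ)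
    (hK : ∀ i σ, c i σ ≤ K) (Λ : Finset (Site d)) {f : C(Config d, ℝ)} (hf : 0 ≤ f) :
    0 ≤ (finGen c Λ + (K * Λ.card) • (1 : C(Config d, ℝ) →L[ℝ] C(Config d, ℝ))) f := by
  intro σ
  have h1 : ∑ i ∈ Λ, c i σ * (f (flip i σ) - f σ) =
      ∑ i ∈ Λ, c i σ * f (flip i σ) - (∑ i ∈ Λ, c i σ) * f σ := by
    rw [Finset.sum_mul, ← Finset.sum_sub_distrib]
    exact Finset.sum_congr rfl fun _ _ => by ring
  have h2 : 0 ≤ ∑ i ∈ Λ, c i σ * f (flip i σ) :=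
    Finset.sum_nonneg fun i _ => mul_nonneg (hc i σ) (hf _)
  have h3 : (∑ i ∈ Λ, c i σ) * f σ ≤ K * Λ.card * f σ :=
    mul_le_mul_of_nonneg_right (sum_rates_le hK Λ σ) (hf σ)
  change (0 : ℝ) ≤ finGen c Λ f σ + K * Λ.card * f σ
  rw [finGen_apply, h1]
  linarith

/-- One application of the shifted generator acts on oscillation profiles at most like the shifted
matrix `T + K |Λ|`; iterating this compares the two exponentials term by term. -/
theorem osc_finGen_add_smul_le {c : Site d → C(Config d, ℝ)} {K : ℝ} (hc : ∀ i σ, 0 ≤ c i σ)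
    (hK : ∀ i σ, c i σ ≤ K) (Λ : Finset (Site d)) {f : C(Config d, ℝ)} {v : Site d → ℝ}
    (hf : ∀ i, osc f i ≤ v i) {i : Site d} {w : ℝ}
    (hw : HasSum (fun j => dependence c j i * v j) w) :
    osc ((finGen c Λ + (K * Λ.card) • (1 : C(Config d, ℝ) →L[ℝ] C(Config d, ℝ))) f) i ≤
      K * Λ.card * v i + w := by
  refine osc_le fun σ => ?_
  simp only [add_apply, smul_apply,
    one_apply_eq_self, ContinuousMap.add_apply, ContinuousMap.smul_apply, smul_eq_mul,
    finGen_apply]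
  have hv : ∀ j, 0 ≤ v j := fun j => (osc_nonneg f j).trans (hf j)
  -- Discrete Leibniz rule: either the rate `c j` feels the flip at `i`, or the two flips are
  -- exchanged.
  have hterm : ∀ j ∈ Λ, c j (flip i σ) * (f (flip j (flip i σ)) - f (flip i σ)) -
      c j σ * (f (flip j σ) - f σ) ≤
      dependence c j i * v j + c j σ * (v i - (f (flip i σ) - f σ)) := fun j _ => by
    have h1 : (c j (flip i σ) - c j σ) * (f (flip j (flip i σ)) - f (flip i σ)) ≤
        dependence c j i * v j := by
      refine (le_abs_self _).trans ?_
      rw [abs_mul]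
      exact mul_le_mul (abs_flip_sub_le_osc _ _ _) ((abs_flip_sub_le_osc _ _ _).trans (hf j))
        (abs_nonneg _) (osc_nonneg _ _)
    have h2 : c j σ * (f (flip i (flip j σ)) - f (flip j σ)) ≤ c j σ * v i :=
      mul_le_mul_of_nonneg_left ((flip_sub_le_osc f i _).trans (hf i)) (hc j σ)
    rw [flip_comm i j] at h2
    linarith
  have hsum := Finset.sum_le_sum hterm
  rw [Finset.sum_sub_distrib, Finset.sum_add_distrib, ← Finset.sum_mul] at hsum
  have h1 : ∑ j ∈ Λ, dependence c j i * v j ≤ w :=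
    sum_le_hasSum _ (fun j _ => mul_nonneg (osc_nonneg _ _) (hv j)) hw
  have h2 : (∑ j ∈ Λ, c j σ) * (v i - (f (flip i σ) - f σ)) ≤
      K * Λ.card * (v i - (f (flip i σ) - f σ)) :=
    mul_le_mul_of_nonneg_right (sum_rates_le hK Λ σ)
      (sub_nonneg.2 ((flip_sub_le_osc f i σ).trans (hf i)))
  linarith

/-! ### Exponentials of bounded operators -/

/-- The exponential `exp(sA)` of a bounded operator. -/
def expOp {E : Type*} [NormedAddCommGroup E] [NormedSpace ℝ E] (A : E →L[ℝ] E) (s : ℝ) :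
    E →L[ℝ] E :=
  NormedSpace.exp (s • A)

section ExpOp

variable {E : Type*} [NormedAddCommGroup E] [NormedSpace ℝ E]

theorem expOp_zero (A : E →L[ℝ] E) : expOp A 0 = 1 := by
  rw [expOp, zero_smul, NormedSpace.exp_zero]

variable [CompleteSpace E]

theorem hasSum_expOp_apply (A : E →L[ℝ] E) (s : ℝ) (x : E) :
    HasSum (fun k : ℕ => ((k.factorial : ℝ)⁻¹ * s ^ k) • (A ^ k) x) (expOp A s x) := by
  have h := NormedSpace.exp_series_hasSum_exp' (𝕂 := ℝ) (s • A)
  have h' := (ContinuousLinearMap.apply ℝ E x).hasSum h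
  simpa [expOp, Function.comp_def, smul_pow, smul_smul] using h'

/-- A scalar shift only contributes a positive factor, so it can be added to make all power series
terms comparable and cancelled afterwards. -/
theorem expOp_add_smul_one (A : E →L[ℝ] E) (R s : ℝ) :
    expOp (A + R • (1 : E →L[ℝ] E)) s = Real.exp (s * R) • expOp A s := by
  let : NormedAlgebra ℚ (E →L[ℝ] E) := NormedAlgebra.restrictScalars ℚ ℝ _
  have h1 : s • (A + R • (1 : E →L[ℝ] E)) = s • A + algebraMap ℝ (E →L[ℝ] E) (s * R) := by
    rw [smul_add, smul_smul, Algebra.algebraMap_eq_smul_one]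
  rw [expOp, h1, NormedSpace.exp_add_of_commute (Algebra.commutes _ _).symm,
    ← NormedSpace.algebraMap_exp_comm, ← Real.exp_eq_exp_ℝ, ← Algebra.commutes, ← Algebra.smul_def,
    expOp]

theorem hasDerivAt_expOp (A : E →L[ℝ] E) (s : ℝ) :
    HasDerivAt (expOp A) (expOp A s * A) s :=
  hasDerivAt_exp_smul_const A s

theorem hasDerivAt_expOp_apply (A : E →L[ℝ] E) (s : ℝ) (x : E) :
    HasDerivAt (fun r => expOp A r x) (A (expOp A s x)) s :=
  (ContinuousLinearMap.apply ℝ E x).hasFDerivAt.comp_hasDerivAt s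
    (hasDerivAt_exp_smul_const' A s)

end ExpOp

/-! ### Finite-volume semigroups -/

/-- The semigroup of the dynamics in which only the spins in `Λ` are flipped. -/
def flow (c : Site d → C(Config d, ℝ)) (Λ : Finset (Site d)) (s : ℝ) :
    C(Config d, ℝ) →L[ℝ] C(Config d, ℝ) :=
  expOp (finGen c Λ) s

theorem flow_zero (c : Site d → C(Config d, ℝ)) (Λ : Finset (Site d)) : flow c Λ 0 = 1 := 
  expOp_zero _

theorem expOp_add_smul_apply (c : Site d → C(Config d, ℝ)) (Λ : Finset (Site d)) (R s : ℝ)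
    (f : C(Config d, ℝ)) :
    expOp (finGen c Λ + R • (1 : C(Config d, ℝ) →L[ℝ] C(Config d, ℝ))) s f =
      Real.exp (s * R) • flow c Λ s f := by
  rw [expOp_add_smul_one]; rfl

theorem flow_nonneg {c : Site d → C(Config d, ℝ)} {K : ℝ} (hc : ∀ i σ, 0 ≤ c i σ)
    (hK : ∀ i σ, c i σ ≤ K) (Λ : Finset (Site d)) {s : ℝ} (hs : 0 ≤ s)
    {f : C(Config d, ℝ)} (hf : 0 ≤ f) : 0 ≤ flow c Λ s f := by
  set A := finGen c Λ + (K * Λ.card) • (1 : C(Config d, ℝ) →L[ℝ] C(Config d, ℝ)) with hA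
  have hpow : ∀ k : ℕ, 0 ≤ (A ^ k) f := fun k => by
    induction k with
    | zero => simpa using hf
    | succ k ih => rw [pow_succ']; exact finGen_add_smul_nonneg hc hK Λ ih
  intro σ
  have h1 := (ContinuousMap.evalCLM ℝ σ).hasSum (hasSum_expOp_apply A s f)
  have h2 := h1.nonneg fun k => by
    have h3 : 0 ≤ (A ^ k) f σ := hpow k σ
    simp only [ContinuousMap.evalCLM_apply, ContinuousMap.smul_apply, smul_eq_mul]
    positivity
  rw [hA, expOp_add_smul_apply] at h2
  simp only [ContinuousMap.evalCLM_apply, ContinuousMap.smul_apply, smul_eq_mul] at h2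
  exact nonneg_of_mul_nonneg_right h2 (Real.exp_pos _)

theorem flow_one (c : Site d → C(Config d, ℝ)) (Λ : Finset (Site d)) (s : ℝ) :
    flow c Λ s 1 = 1 := by
  have h0 : finGen c Λ 1 = 0 := by ext σ; simp [finGen_apply]
  refine (hasSum_expOp_apply (finGen c Λ) s 1).unique ?_
  convert hasSum_single 0 fun k hk => ?_
  · simp
  · obtain ⟨k, rfl⟩ := Nat.exists_eq_succ_of_ne_zero hk
    rw [pow_succ (finGen c Λ), mul_apply_eq_comp, h0, map_zero, smul_zero]

theorem flow_mono {c : Site d → C(Config d, ℝ)} {K : ℝ} (hc : ∀ i σ, 0 ≤ c i σ)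
    (hK : ∀ i σ, c i σ ≤ K) (Λ : Finset (Site d)) {s : ℝ} (hs : 0 ≤ s)
    {f g : C(Config d, ℝ)} (hfg : f ≤ g) : flow c Λ s f ≤ flow c Λ s g := by
  have h := flow_nonneg hc hK Λ hs (sub_nonneg.2 hfg)
  rwa [map_sub, sub_nonneg] at h

variable {p : ENNReal} [Fact (1 ≤ p)]

theorem lp_pow_apply_nonneg {T : lp (fun _ : Site d => ℝ) p →L[ℝ] lp (fun _ : Site d => ℝ) p}
    {G : Site d → Site d → ℝ} (hG : ∀ i j, 0 ≤ G i j)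
    (hT : ∀ v i, HasSum (fun j => G i j * v j) (T v i))
    {v : lp (fun _ : Site d => ℝ) p} (hv : ∀ i, 0 ≤ v i) (k : ℕ) (i : Site d) :
    0 ≤ (T ^ k) v i := by
  induction k generalizing i with
  | zero => exact hv i
  | succ k ih =>
    rw [pow_succ']
    exact (hT _ i).nonneg fun j => mul_nonneg (hG i j) (ih j)

theorem hasSum_exp_lp_apply (T : lp (fun _ : Site d => ℝ) p →L[ℝ] lp (fun _ : Site d => ℝ) p)
    (s : ℝ) (v : lp (fun _ : Site d => ℝ) p) (i : Site d) :
    HasSum (fun k : ℕ => ((k.factorial : ℝ)⁻¹ * s ^ k) * (T ^ k) v i)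
      (expOp T s v i) :=
  (lp.evalCLM ℝ (fun _ : Site d => ℝ) p i).hasSum (hasSum_expOp_apply T s v)

theorem exp_lp_apply_mono {T : lp (fun _ : Site d => ℝ) p →L[ℝ] lp (fun _ : Site d => ℝ) p}
    {G : Site d → Site d → ℝ} (hG : ∀ i j, 0 ≤ G i j)
    (hT : ∀ v i, HasSum (fun j => G i j * v j) (T v i))
    {v : lp (fun _ : Site d => ℝ) p} (hv : ∀ i, 0 ≤ v i) {s t : ℝ} (hs : 0 ≤ s) (hst : s ≤ t)
    (i : Site d) : expOp T s v i ≤ expOp T t v i := by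
  refine hasSum_le (fun k => ?_) (hasSum_exp_lp_apply T s v i) (hasSum_exp_lp_apply T t v i)
  have := lp_pow_apply_nonneg hG hT hv k i
  gcongr

/-- The shift depends on `Λ`, but its factor cancels and the bound does not. The exponent `p = 1`
serves the infinite-volume limit, `p = 2` the variance bound. -/
theorem osc_flow_le {c : Site d → C(Config d, ℝ)} {K : ℝ} (hc : ∀ i σ, 0 ≤ c i σ)
    (hK : ∀ i σ, c i σ ≤ K)
    {T : lp (fun _ : Site d => ℝ) p →L[ℝ] lp (fun _ : Site d => ℝ) p}
    (hT : ∀ v i, HasSum (fun j => dependence c j i * v j) (T v i))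
    (Λ : Finset (Site d)) {f : C(Config d, ℝ)} {v : lp (fun _ : Site d => ℝ) p}
    (hf : ∀ i, osc f i ≤ v i) {s t : ℝ} (hs : 0 ≤ s) (hst : s ≤ t) (i : Site d) :
    osc (flow c Λ s f) i ≤ expOp T t v i := by
  have hv : ∀ j, 0 ≤ v j := fun j => (osc_nonneg f j).trans (hf j)
  refine le_trans ?_ (exp_lp_apply_mono (fun i j => osc_nonneg (c j) i) hT hv hs hst i)
  set R : ℝ := K * Λ.card with hR
  set A := finGen c Λ + R • (1 : C(Config d, ℝ) →L[ℝ] C(Config d, ℝ)) with hA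
  set B := T + R • (1 : lp (fun _ : Site d => ℝ) p →L[ℝ] lp (fun _ : Site d => ℝ) p) with hB
  have hpow : ∀ (k : ℕ) (i : Site d), osc ((A ^ k) f) i ≤ (B ^ k) v i := fun k => by
    induction k with
    | zero => simpa using hf
    | succ k ih =>
      intro i
      rw [pow_succ', pow_succ']
      refine (osc_finGen_add_smul_le hc hK Λ ih (hT _ i)).trans (le_of_eq ?_)
      rw [add_comm]; rfl
  refine osc_le fun σ => ?_
  have h1 := ((ContinuousMap.evalCLM ℝ (flip i σ)).hasSum (hasSum_expOp_apply A s f)).sub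
    ((ContinuousMap.evalCLM ℝ σ).hasSum (hasSum_expOp_apply A s f))
  have h2 := hasSum_le (fun k => ?_) h1 (hasSum_exp_lp_apply B s v i)
  · rw [hA, hB, expOp_add_smul_apply, expOp_add_smul_one] at h2
    simp only [ContinuousMap.evalCLM_apply, ContinuousMap.smul_apply, smul_eq_mul,
      ← mul_sub] at h2
    change _ ≤ Real.exp (s * R) * _ at h2
    exact le_of_mul_le_mul_left h2 (Real.exp_pos _)
  · have h3 := (flip_sub_le_osc ((A ^ k) f) i σ).trans (hpow k i)
    simp only [ContinuousMap.evalCLM_apply, ContinuousMap.smul_apply, smul_eq_mul,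
      ← mul_sub]
    exact mul_le_mul_of_nonneg_left h3 (by positivity)

/-! ### The transposed dependence matrix on sequence spaces -/

theorem exists_transpose_dependence_l2 {c : Site d → C(Config d, ℝ)}
    (hΓ : DependenceBoundedL2 c) :
    ∃ T : lp (fun _ : Site d => ℝ) 2 →L[ℝ] lp (fun _ : Site d => ℝ) 2,
      ∀ v i, HasSum (fun j => dependence c j i * v j) (T v i) := by
  obtain ⟨T, hT⟩ := hΓ
  refine ⟨ContinuousLinearMap.adjoint T, fun v i => ?_⟩
  -- Column `i` of `Γ` is the image of a basis vector; pairing it with `v` gives coordinate `i` of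
  -- the adjoint.
  have hentry : ∀ j, T (lp.single 2 i 1) j = dependence c j i := fun j => by
    refine (hT (lp.single 2 i 1) j).unique ?_
    convert hasSum_single i fun k hk => ?_ using 1
    · simp
    · simp [hk]
  have h1 := lp.hasSum_inner (𝕜 := ℝ) (T (lp.single 2 i 1)) v
  rw [← ContinuousLinearMap.adjoint_inner_right, lp.inner_single_left] at h1
  simpa [hentry, mul_comm] using h1

/-- Rows of `Γ` are columns of the transpose and have `ℓ¹` norm at most `M`, so `∑ v_j • row j`
converges absolutely. -/
theorem exists_transpose_dependence_l1 {c : Site d → C(Config d, ℝ)} {M : ℝ}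
    (hM : ∀ i, Summable (dependence c i) ∧ ∑' j, dependence c i j ≤ M) :
    ∃ T : lp (fun _ : Site d => ℝ) 1 →L[ℝ] lp (fun _ : Site d => ℝ) 1,
      ∀ v i, HasSum (fun j => dependence c j i * v j) (T v i) := by
  have hmem : ∀ j, Memℓp (dependence c j) 1 := fun j => by
    refine memℓp_gen ?_
    simpa using (hM j).1.norm
  let row : Site d → lp (fun _ : Site d => ℝ) 1 := fun j => ⟨dependence c j, hmem j⟩
  have hrow : ∀ j, ‖row j‖ ≤ M := fun j => by
    rw [lp.norm_eq_tsum_rpow (by simp)]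
    refine le_trans (le_of_eq ?_) (hM j).2
    simp [row, abs_of_nonneg (osc_nonneg _ _), dependence]
  have hnorm : ∀ v : lp (fun _ : Site d => ℝ) 1, HasSum (fun j => ‖v j‖) ‖v‖ := fun v => by
    simpa using lp.hasSum_norm (by simp) v
  have hle : ∀ (v : lp (fun _ : Site d => ℝ) 1) j, ‖v j • row j‖ ≤ ‖v j‖ * M := fun v j => by
    rw [norm_smul]
    exact mul_le_mul_of_nonneg_left (hrow j) (norm_nonneg _)
  have hsum : ∀ v : lp (fun _ : Site d => ℝ) 1, Summable fun j => v j • row j := fun v =>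
    Summable.of_norm_bounded ((hnorm v).summable.mul_right M) (hle v)
  refine ⟨LinearMap.mkContinuous
    { toFun := fun v => ∑' j, v j • row j
      map_add' := fun v w => by
        rw [← (hsum v).tsum_add (hsum w)]
        exact tsum_congr fun j => add_smul _ _ _
      map_smul' := fun a v => by
        rw [RingHom.id_apply, ← (hsum v).tsum_const_smul]
        exact tsum_congr fun j => mul_smul _ _ _ } M fun v => ?_, fun v i => ?_⟩
  · rw [mul_comm]
    exact tsum_of_norm_bounded ((hnorm v).mul_right M) (hle v)
  · have h := (lp.evalCLM ℝ (fun _ : Site d => ℝ) 1 i).hasSum (hsum v).hasSum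
    have hfun : (fun j => dependence c j i * v j) =
        lp.evalCLM ℝ (fun _ : Site d => ℝ) 1 i ∘ fun j => v j • row j :=
      funext fun j => mul_comm _ _
    rw [hfun]
    exact h

/-! ### The variance created by the finite-volume dynamics -/

theorem hasDerivAt_flow_apply (c : Site d → C(Config d, ℝ)) (Λ : Finset (Site d)) (s : ℝ)
    (f : C(Config d, ℝ)) :
    HasDerivAt (fun r => flow c Λ r f) (finGen c Λ (flow c Λ s f)) s :=
  hasDerivAt_expOp_apply _ s f

/-- The carré du champ identity for the finite-volume generator. -/
theorem finGen_sq_sub (c : Site d → C(Config d, ℝ)) (Λ : Finset (Site d)) (g : C(Config d, ℝ))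
    (σ : Config d) :
    (finGen c Λ (g * g) - (finGen c Λ g * g + g * finGen c Λ g)) σ =
      ∑ i ∈ Λ, c i σ * (g (flip i σ) - g σ) ^ 2 := by
  simp only [ContinuousMap.sub_apply, ContinuousMap.add_apply, ContinuousMap.mul_apply,
    finGen_apply, Finset.sum_mul, Finset.mul_sum, ← Finset.sum_add_distrib,
    ← Finset.sum_sub_distrib]
  exact Finset.sum_congr rfl fun _ _ => by ring

theorem flow_sq_sub_sq_flow_le {c : Site d → C(Config d, ℝ)} {K : ℝ} (hc : ∀ i σ, 0 ≤ c i σ)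
    (hK : ∀ i σ, c i σ ≤ K) (Λ : Finset (Site d)) {f : C(Config d, ℝ)} {w : Site d → ℝ}
    {t B : ℝ} (ht : 0 ≤ t) (hw : ∀ s, 0 ≤ s → s ≤ t → ∀ i, osc (flow c Λ s f) i ≤ w i)
    (hB : ∀ Λ : Finset (Site d), ∑ i ∈ Λ, w i ^ 2 ≤ B) (σ : Config d) :
    flow c Λ t (f * f) σ - flow c Λ t f σ ^ 2 ≤ K * B * t := by
  have hK0 : 0 ≤ K := (hc 0 1).trans (hK 0 1)
  -- Interpolation: `s ↦ flow s (g s * g s)` runs from `(flow t f)²` to `flow t (f²)`, with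
  -- derivative `flow s` of the carré du champ of `g s`.
  let g : ℝ → C(Config d, ℝ) := fun s => flow c Λ (t - s) f
  have hg : ∀ s, HasDerivAt g (-finGen c Λ (g s)) s := fun s => by
    have h := (hasDerivAt_flow_apply c Λ (t - s) f).scomp s ((hasDerivAt_id s).const_sub t)
    exact h.congr_deriv (neg_one_smul ℝ _)
  have hgg : ∀ s, HasDerivAt (fun s => flow c Λ s (g s * g s))
      (flow c Λ s (finGen c Λ (g s * g s) -
        (finGen c Λ (g s) * g s + g s * finGen c Λ (g s)))) s := fun s => by
    have h := (hasDerivAt_expOp (finGen c Λ) s).clm_apply ((hg s).mul (hg s))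
    refine h.congr_deriv ?_
    rw [map_sub, sub_eq_add_neg, mul_apply_eq_comp, ← map_neg (flow c Λ s), neg_add, neg_mul,
      mul_neg]
    rfl
  have hψ : ∀ s, HasDerivAt (fun s => flow c Λ s (g s * g s) σ)
      (flow c Λ s (finGen c Λ (g s * g s) -
        (finGen c Λ (g s) * g s + g s * finGen c Λ (g s))) σ) s := fun s =>
    (ContinuousMap.evalCLM (M := ℝ) ℝ σ).hasFDerivAt.comp_hasDerivAt s (hgg s)
  have hbound : ∀ s ∈ interior (Set.Icc 0 t),
      deriv (fun s => flow c Λ s (g s * g s) σ) s ≤ K * B := fun s hs => by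
    rw [interior_Icc] at hs
    rw [(hψ s).deriv]
    have hle : finGen c Λ (g s * g s) - (finGen c Λ (g s) * g s + g s * finGen c Λ (g s)) ≤
        (K * B) • (1 : C(Config d, ℝ)) := fun η => by
      change _ ≤ K * B * 1
      rw [mul_one]
      refine (finGen_sq_sub c Λ (g s) η).le.trans ?_
      refine le_trans ?_ (mul_le_mul_of_nonneg_left (hB Λ) hK0)
      rw [Finset.mul_sum]
      refine Finset.sum_le_sum fun i _ => mul_le_mul (hK i η) ?_ (sq_nonneg _) hK0
      refine sq_le_sq' ?_ ?_
      all_goals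
        have h1 := abs_le.1 (abs_flip_sub_le_osc (g s) i η)
        have h2 := hw (t - s) (by linarith [hs.2]) (by linarith [hs.1]) i
        change osc (g s) i ≤ w i at h2
        linarith [h1.1, h1.2]
    have h := flow_mono hc hK Λ hs.1.le hle σ
    rw [map_smul, flow_one] at h
    simpa using h
  have h := (convex_Icc 0 t).image_sub_le_mul_sub_of_deriv_le
    (fun s _ => (hψ s).continuousAt.continuousWithinAt)
    (fun s _ => (hψ s).differentiableAt.differentiableWithinAt) hbound 0
    (Set.left_mem_Icc.2 ht) t (Set.right_mem_Icc.2 ht) ht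
  simp only [g, sub_self, sub_zero, flow_zero] at h
  simp only [one_apply_eq_self, ContinuousMap.mul_apply] at h
  rw [sq]
  linarith

/-! ### Approximation by local functions -/

/-- The configuration which agrees with `σ` on `Λ` and is constant outside `Λ`. -/
def restrictTo (Λ : Finset (Site d)) (σ : Config d) : Config d := fun i => if i ∈ Λ then σ i else 1

theorem continuous_restrictTo (Λ : Finset (Site d)) : Continuous (restrictTo Λ) := by
  refine continuous_pi fun i => ?_
  by_cases h : i ∈ Λ
  · simpa [restrictTo, h] using continuous_apply i
  · simpa [restrictTo, h] using continuous_const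

/-- The local function obtained from `f` by freezing the spins outside `Λ`. -/
def truncate (Λ : Finset (Site d)) (f : C(Config d, ℝ)) : C(Config d, ℝ) :=
  f.comp ⟨restrictTo Λ, continuous_restrictTo Λ⟩

theorem truncate_apply (Λ : Finset (Site d)) (f : C(Config d, ℝ)) (σ : Config d) :
    truncate Λ f σ = f (restrictTo Λ σ) := rfl

theorem isLocal_truncate (Λ : Finset (Site d)) (f : C(Config d, ℝ)) : IsLocal (truncate Λ f) := by
  refine ⟨Λ, fun σ η h => ?_⟩
  rw [truncate_apply, truncate_apply]
  congr 1
  funext i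
  by_cases hi : i ∈ Λ
  · simp [restrictTo, hi, h i hi]
  · simp [restrictTo, hi]

theorem restrictTo_flip_of_mem {Λ : Finset (Site d)} {i : Site d} (hi : i ∈ Λ) (σ : Config d) :
    restrictTo Λ (flip i σ) = flip i (restrictTo Λ σ) := by
  funext j
  simp only [restrictTo, flip_apply]
  by_cases hj : j = i
  · subst hj; simp [hi]
  · simp [hj]

theorem restrictTo_flip_of_notMem {Λ : Finset (Site d)} {i : Site d} (hi : i ∉ Λ) (σ : Config d) :
    restrictTo Λ (flip i σ) = restrictTo Λ σ := by
  funext j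
  simp only [restrictTo, flip_apply]
  by_cases hj : j = i
  · subst hj; simp [hi]
  · simp [hj]

theorem osc_truncate_le (Λ : Finset (Site d)) (f : C(Config d, ℝ)) (i : Site d) :
    osc (truncate Λ f) i ≤ osc f i := by
  refine osc_le fun σ => ?_
  rw [truncate_apply, truncate_apply]
  by_cases hi : i ∈ Λ
  · rw [restrictTo_flip_of_mem hi]
    exact flip_sub_le_osc f i _
  · rw [restrictTo_flip_of_notMem hi, sub_self]
    exact osc_nonneg f i

/-- Near each configuration, continuity depends on finitely many spins up to `ε`; compactness makes
the convergence uniform. -/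
theorem tendsto_truncate (f : C(Config d, ℝ)) :
    Tendsto (fun Λ => truncate Λ f) atTop (𝓝 f) := by
  rw [ContinuousMap.tendsto_iff_tendstoLocallyUniformly, Metric.tendstoLocallyUniformly_iff]
  intro ε hε σ
  have hopen : IsOpen (f ⁻¹' Metric.ball (f σ) (ε / 2)) := Metric.isOpen_ball.preimage f.continuous
  obtain ⟨I, u, hu, hsub⟩ := isOpen_pi_iff.1 hopen σ (by simp [hε])
  refine ⟨(I : Set (Site d)).pi u,
    (isOpen_set_pi I.finite_toSet fun i hi => (hu i hi).1).mem_nhds fun i hi => (hu i hi).2, ?_⟩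
  filter_upwards [eventually_ge_atTop I] with Λ hΛ η hη
  have h1 : f η ∈ Metric.ball (f σ) (ε / 2) := hsub hη
  have h2 : f (restrictTo Λ η) ∈ Metric.ball (f σ) (ε / 2) := hsub fun i hi => by
    simpa [restrictTo, hΛ hi] using hη i hi
  calc dist (f η) (f (restrictTo Λ η)) ≤ dist (f η) (f σ) + dist (f (restrictTo Λ η)) (f σ) :=
        dist_triangle_right _ _ _
    _ < ε := by
        rw [Metric.mem_ball] at h1 h2
        linarith

theorem IsLocal.summable_osc {f : C(Config d, ℝ)} (hf : IsLocal f) : Summable (osc f) := by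
  obtain ⟨Λ, hΛ⟩ := hf
  refine summable_of_ne_finset_zero (s := Λ) fun i hi => le_antisymm (osc_le fun σ => ?_)
    (osc_nonneg f i)
  refine (sub_eq_zero.2 (hΛ _ _ fun j hj => ?_)).le
  rw [flip_apply, if_neg (ne_of_mem_of_not_mem hj hi)]

theorem IsLocal.mul_self {f : C(Config d, ℝ)} (hf : IsLocal f) : IsLocal (f * f) := by
  obtain ⟨Λ, hΛ⟩ := hf
  exact ⟨Λ, fun σ η h => by simp [hΛ σ η h]⟩

/-! ### Functions of summable oscillation lie in the domain of the generator -/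

theorem norm_rate_mul_grad_le {c : Site d → C(Config d, ℝ)} {K : ℝ} (hc : ∀ i σ, 0 ≤ c i σ)
    (hK : ∀ i σ, c i σ ≤ K) (i : Site d) (f : C(Config d, ℝ)) :
    ‖c i * grad i f‖ ≤ K * osc f i := by
  have hK0 : 0 ≤ K := (hc i 1).trans (hK i 1)
  have hci : ‖c i‖ ≤ K := (ContinuousMap.norm_le _ hK0).2 fun σ => by
    rw [Real.norm_of_nonneg (hc i σ)]
    exact hK i σ
  exact (norm_mul_le _ _).trans
    (mul_le_mul hci (norm_grad_le_osc i f) (norm_nonneg _) hK0)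

/-- Truncations of `f` are local, and their images converge by domination with `K * osc f i`. -/
theorem mem_closure_pregeneratorGraph {c : Site d → C(Config d, ℝ)} {K : ℝ}
    (hc : ∀ i σ, 0 ≤ c i σ) (hK : ∀ i σ, c i σ ≤ K) {f : C(Config d, ℝ)}
    (hf : Summable (osc f)) :
    (f, ∑' i, c i * grad i f) ∈ closure (pregeneratorGraph c) := by
  have hK0 : 0 ≤ K := (hc 0 1).trans (hK 0 1)
  have hbound : ∀ (Λ : Finset (Site d)) i, ‖c i * grad i (truncate Λ f)‖ ≤ K * osc f i :=
    fun Λ i => (norm_rate_mul_grad_le hc hK i _).trans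
      (mul_le_mul_of_nonneg_left (osc_truncate_le Λ f i) hK0)
  have hlim : Tendsto (fun Λ => ∑' i, c i * grad i (truncate Λ f)) atTop
      (𝓝 (∑' i, c i * grad i f)) := by
    refine tendsto_tsum_of_dominated_convergence (hf.mul_left K) (fun i => ?_)
      (Eventually.of_forall hbound)
    exact tendsto_const_nhds.mul (((grad i).continuous.tendsto f).comp (tendsto_truncate f))
  refine mem_closure_of_tendsto ((tendsto_truncate f).prodMk_nhds hlim)
    (Eventually.of_forall fun Λ => ⟨isLocal_truncate Λ f, fun σ => ?_⟩)
  have hs : Summable fun i => c i * grad i (truncate Λ f) :=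
    Summable.of_norm_bounded (hf.mul_left K) (hbound Λ)
  exact (ContinuousMap.evalCLM (M := ℝ) ℝ σ).map_tsum hs

/-! ### Comparison of Feller semigroups with approximate solutions of the evolution equation -/

namespace FellerSemigroup

variable {X : Type*} [TopologicalSpace X] [CompactSpace X]

theorem norm_op_apply_le (S : FellerSemigroup X) (t : ℝ≥0) (f : C(X, ℝ)) :
    ‖S.op t f‖ ≤ ‖f‖ := by
  refine (ContinuousMap.norm_le _ (norm_nonneg _)).2 fun x => abs_le.2 ⟨?_, ?_⟩
  · have h := S.op_nonneg t (‖f‖ • (1 : C(X, ℝ)) + f) (fun y => by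
      have := (abs_le.1 (f.norm_coe_le_norm y)).1
      change (0 : ℝ) ≤ ‖f‖ * 1 + f y
      linarith) x
    rw [map_add, map_smul, S.op_one] at h
    change (0 : ℝ) ≤ ‖f‖ * 1 + S.op t f x at h
    linarith
  · have h := S.op_nonneg t (‖f‖ • (1 : C(X, ℝ)) - f) (fun y => by
      have := (abs_le.1 (f.norm_coe_le_norm y)).2
      change (0 : ℝ) ≤ ‖f‖ * 1 - f y
      linarith) x
    rw [map_sub, map_smul, S.op_one] at h
    change (0 : ℝ) ≤ ‖f‖ * 1 - S.op t f x at h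
    linarith

theorem continuous_op_apply (S : FellerSemigroup X) {r : ℝ → ℝ≥0} {g : ℝ → C(X, ℝ)}
    (hr : Continuous r) (hg : Continuous g) : Continuous fun s => S.op (r s) (g s) := by
  refine continuous_iff_continuousAt.2 fun s => ?_
  have h1 : Tendsto (fun z => S.op (r z) (g z - g s)) (𝓝 s) (𝓝 0) := by
    refine squeeze_zero_norm (fun z => S.norm_op_apply_le _ _) ?_
    have h := ((hg.tendsto s).sub_const (g s)).norm
    rwa [sub_self, norm_zero] at h
  have h2 := h1.add (((S.continuous_op (g s)).comp hr).tendsto s)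
  rw [zero_add] at h2
  refine h2.congr fun z => ?_
  simp

/-- Duhamel's comparison: if `g` solves `g' = a` while the generator of `S` maps `g s` to `b s`,
and `‖a - b‖ < ε`, then `g t` is within `ε t` of `S(t) (g 0)`. -/
theorem norm_op_apply_sub_le (S : FellerSemigroup X) {g a b : ℝ → C(X, ℝ)} {t ε : ℝ}
    (ht : 0 ≤ t) (hg : ∀ s, HasDerivAt g (a s) s)
    (hb : ∀ s ∈ Set.Ico 0 t, (g s, b s) ∈ S.generatorGraph)
    (hε : ∀ s ∈ Set.Ico 0 t, ‖a s - b s‖ < ε) :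
    ‖g t - S.op t.toNNReal (g 0)‖ ≤ ε * t := by
  have hgc : Continuous g := continuous_iff_continuousAt.2 fun s => (hg s).continuousAt
  -- `φ` vanishes at `0`, and its norm grows with right slope below `ε`. Right slopes suffice, which
  -- suits a generator defined by a one-sided limit.
  let φ : ℝ → C(X, ℝ) := fun s => S.op (t - s).toNNReal (g s) - S.op t.toNNReal (g 0)
  have hφ : Continuous φ :=
    (S.continuous_op_apply (by fun_prop) hgc).sub continuous_const
  have hslope : ∀ x ∈ Set.Ico 0 t, ∀ r, ‖a x - b x‖ < r →
      ∃ᶠ z in 𝓝[>] x, slope (norm ∘ φ) x z < r := fun x hx r hr => by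
    have hshift : Tendsto (fun z => (z - x).toNNReal) (𝓝[>] x) (𝓝[>] 0) := by
      refine tendsto_nhdsWithin_iff.2 ⟨?_, ?_⟩
      · have : Continuous fun z : ℝ => (z - x).toNNReal := by fun_prop
        have h := this.tendsto x
        simp only [sub_self, Real.toNNReal_zero] at h
        exact h.mono_left nhdsWithin_le_nhds
      · filter_upwards [self_mem_nhdsWithin] with z hz
        exact Real.toNNReal_pos.2 (sub_pos.2 hz)
    have h1 : Tendsto (slope g x) (𝓝[>] x) (𝓝 (a x)) :=
      (hasDerivAt_iff_tendsto_slope.1 (hg x)).mono_left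
        (nhdsWithin_mono _ fun z hz => ne_of_gt hz)
    have h2 := (h1.sub ((hb x hx).comp hshift)).norm
    refine Eventually.frequently ?_
    filter_upwards [h2.eventually (gt_mem_nhds hr), self_mem_nhdsWithin,
      Ioo_mem_nhdsGT hx.2] with z hz hxz hzt
    have hzx : 0 < z - x := sub_pos.2 hxz
    refine lt_of_le_of_lt ?_ hz
    -- The semigroup law factors out the contraction `S(t - z)`, leaving the increment of `g` minus
    -- that of the semigroup started from `g x`.
    have hsplit : φ z - φ x = S.op (t - z).toNNReal
        ((g z - g x) - (S.op (z - x).toNNReal (g x) - g x)) := by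
      have h3 : S.op (t - x).toNNReal (g x) =
          S.op (t - z).toNNReal (S.op (z - x).toNNReal (g x)) := by
        rw [← S.op_add, ← Real.toNNReal_add (by linarith [hzt.2]) hzx.le]
        congr 3
        ring
      simp only [φ, h3, map_sub]
      abel
    have hnorm : ‖φ z‖ - ‖φ x‖ ≤ ‖(g z - g x) - (S.op (z - x).toNNReal (g x) - g x)‖ :=
      (norm_sub_norm_le _ _).trans (hsplit ▸ S.norm_op_apply_le _ _)
    have hrw : slope g x z - (((z - x).toNNReal : ℝ≥0) : ℝ)⁻¹ •
        (S.op (z - x).toNNReal (g x) - g x) =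
        (z - x)⁻¹ • ((g z - g x) - (S.op (z - x).toNNReal (g x) - g x)) := by
      rw [Real.coe_toNNReal _ hzx.le, slope_def_module, ← smul_sub]
    simp only [Function.comp]
    rw [hrw, norm_smul, slope_def_field, norm_inv, Real.norm_of_nonneg hzx.le, div_eq_inv_mul]
    exact mul_le_mul_of_nonneg_left hnorm (inv_nonneg.2 hzx.le)
  have h := image_norm_le_of_liminf_right_slope_norm_lt_deriv_boundary hφ.continuousOn hslope
    (B := fun s => ε * s) (B' := fun _ => ε) (by simp [φ]) (by fun_prop)
    (fun x _ => by simpa using ((hasDerivAt_id x).const_mul ε).hasDerivWithinAt)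
    (fun x hx _ => hε x hx) (Set.right_mem_Icc.2 ht)
  simpa [φ, S.op_zero] using h

end FellerSemigroup

/-! ### Convergence of the finite-volume semigroups -/

theorem tendsto_flow {c : Site d → C(Config d, ℝ)} {K M : ℝ} (hc : ∀ i σ, 0 ≤ c i σ)
    (hK : ∀ i σ, c i σ ≤ K) (hM : ∀ i, Summable (dependence c i) ∧ ∑' j, dependence c i j ≤ M)
    {S : FellerSemigroup (Config d)} (hS : IsSpinFlipSemigroup c S) (t : ℝ≥0)
    {f : C(Config d, ℝ)} (hf : Summable (osc f)) :
    Tendsto (fun Λ => flow c Λ t f) atTop (𝓝 (S.op t f)) := by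
  have hK0 : 0 ≤ K := (hc 0 1).trans (hK 0 1)
  obtain ⟨T, hT⟩ := exists_transpose_dependence_l1 hM
  let v : lp (fun _ : Site d => ℝ) 1 := ⟨osc f, memℓp_gen (by simpa using hf.norm)⟩
  let w : lp (fun _ : Site d => ℝ) 1 := expOp T t v
  have hw : Summable fun i => w i := by
    have h := (lp.hasSum_norm (by simp) w).summable
    simp only [ENNReal.toReal_one, Real.rpow_one] at h
    exact h.of_norm
  have hosc : ∀ (Λ : Finset (Site d)) (s : ℝ), 0 ≤ s → s ≤ t → ∀ i, osc (flow c Λ s f) i ≤ w i :=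
    fun Λ s hs hst i => osc_flow_le hc hK hT Λ (v := v) (fun _ => le_rfl) hs hst i
  have hKw : Summable fun i => K * w i := hw.mul_left K
  -- The comparison needs a strict bound on the defect, hence the slack `δ`, removed in `key'`.
  have key : ∀ Λ : Finset (Site d), ∀ δ > 0,
      ‖flow c Λ t f - S.op t f‖ ≤ (∑' i : {i // i ∉ Λ}, K * w i + δ) * t := fun Λ δ hδ => by
    have h := S.norm_op_apply_sub_le (g := fun s => flow c Λ s f)
      (a := fun s => finGen c Λ (flow c Λ s f)) (b := fun s => ∑' i, c i * grad i (flow c Λ s f))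
      (ε := ∑' i : {i // i ∉ Λ}, K * w i + δ) t.2 (hasDerivAt_flow_apply c Λ · f)
      (fun s hs => by
        have hs' : S.generatorGraph = _ := hS
        rw [hs']
        exact mem_closure_pregeneratorGraph hc hK
          (hw.of_nonneg_of_le (osc_nonneg _) (hosc Λ s hs.1 hs.2.le)))
      (fun s hs => by
        refine lt_of_le_of_lt ?_ (lt_add_of_pos_right _ hδ)
        have hle : ∀ i, ‖c i * grad i (flow c Λ s f)‖ ≤ K * w i := fun i =>
          (norm_rate_mul_grad_le hc hK i _).trans
            (mul_le_mul_of_nonneg_left (hosc Λ s hs.1 hs.2.le i) hK0)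
        -- The two generators differ exactly by the flips outside `Λ`.
        have hsum : Summable fun i => c i * grad i (flow c Λ s f) :=
          Summable.of_norm_bounded hKw hle
        have hsplit := hsum.sum_add_tsum_subtype_compl Λ
        rw [← finGen_eq_sum] at hsplit
        rw [← hsplit, sub_add_cancel_left, norm_neg]
        exact tsum_of_norm_bounded (hKw.subtype _).hasSum fun i => hle i)
    have h0 : flow c Λ 0 f = f := by rw [flow_zero]; rfl
    rw [h0] at h
    simpa using h
  have key' : ∀ Λ : Finset (Site d),
      ‖flow c Λ t f - S.op t f‖ ≤ (∑' i : {i // i ∉ Λ}, K * w i) * t := fun Λ => by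
    have h : Tendsto (fun δ : ℝ => (∑' i : {i // i ∉ Λ}, K * w i + δ) * t) (𝓝[>] 0)
        (𝓝 ((∑' i : {i // i ∉ Λ}, K * w i + 0) * t)) :=
      ((continuous_const.add continuous_id).mul continuous_const).continuousWithinAt
    rw [add_zero] at h
    exact ge_of_tendsto h (by filter_upwards [self_mem_nhdsWithin] with δ hδ using key Λ δ hδ)
  rw [tendsto_iff_norm_sub_tendsto_zero]
  refine squeeze_zero (fun _ => norm_nonneg _) key' ?_
  simpa using (tendsto_tsum_compl_atTop_zero fun i => K * w i).mul_const (t : ℝ)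

/-! ### Estimates for the infinite-volume semigroup -/

theorem lp_two_norm_sq (w : lp (fun _ : Site d => ℝ) 2) : HasSum (fun i => w i ^ 2) (‖w‖ ^ 2) := by
  simpa using lp.hasSum_norm (by simp) w

/-- Local functions come first, since `tendsto_flow` needs summable oscillations. A majorant `v` in
place of `osc f` lets one bound serve all truncations. -/
theorem semigroup_estimates {c : Site d → C(Config d, ℝ)} {K M : ℝ} (hc : ∀ i σ, 0 ≤ c i σ)
    (hK : ∀ i σ, c i σ ≤ K) (hM : ∀ i, Summable (dependence c i) ∧ ∑' j, dependence c i j ≤ M)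
    {S : FellerSemigroup (Config d)} (hS : IsSpinFlipSemigroup c S)
    {T : lp (fun _ : Site d => ℝ) 2 →L[ℝ] lp (fun _ : Site d => ℝ) 2}
    (hT : ∀ v i, HasSum (fun j => dependence c j i * v j) (T v i)) (t : ℝ≥0)
    {f : C(Config d, ℝ)} {v : lp (fun _ : Site d => ℝ) 2} (hf : ∀ i, osc f i ≤ v i) :
    (∀ i, osc (S.op t f) i ≤ expOp T t v i) ∧
      ∀ σ, S.op t (f * f) σ - S.op t f σ ^ 2 ≤ K * ‖expOp T t v‖ ^ 2 * t := by
  set w := expOp T t v with hw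
  have hlocal : ∀ g : C(Config d, ℝ), IsLocal g → (∀ i, osc g i ≤ v i) →
      (∀ i, osc (S.op t g) i ≤ w i) ∧
        ∀ σ, S.op t (g * g) σ - S.op t g σ ^ 2 ≤ K * ‖w‖ ^ 2 * t := fun g hg hgv => by
    have h1 := tendsto_flow hc hK hM hS t hg.summable_osc
    have h2 := tendsto_flow hc hK hM hS t hg.mul_self.summable_osc
    have hosc : ∀ (Λ : Finset (Site d)) (s : ℝ), 0 ≤ s → s ≤ t →
        ∀ i, osc (flow c Λ s g) i ≤ w i :=
      fun Λ s hs hst i => osc_flow_le hc hK hT Λ hgv hs hst i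
    refine ⟨fun i => ?_, fun σ => ?_⟩
    · exact le_of_tendsto (((continuous_osc i).tendsto _).comp h1)
        (Eventually.of_forall fun Λ => hosc Λ t t.2 le_rfl i)
    · have h3 := (((ContinuousMap.evalCLM (M := ℝ) ℝ σ).continuous.tendsto _).comp h2).sub
        ((((ContinuousMap.evalCLM (M := ℝ) ℝ σ).continuous.tendsto _).comp h1).pow 2)
      exact le_of_tendsto h3 (Eventually.of_forall fun Λ =>
        flow_sq_sub_sq_flow_le hc hK Λ t.2 (hosc Λ)
          (fun Λ' => sum_le_hasSum Λ' (fun _ _ => sq_nonneg _) (lp_two_norm_sq w)) σ)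
  have htrunc : ∀ Λ, _ := fun Λ => hlocal (truncate Λ f) (isLocal_truncate Λ f)
    fun i => (osc_truncate_le Λ f i).trans (hf i)
  refine ⟨fun i => ?_, fun σ => ?_⟩
  · exact le_of_tendsto ((((continuous_osc i).comp (S.op t).continuous).tendsto f).comp
      (tendsto_truncate f)) (Eventually.of_forall fun Λ => (htrunc Λ).1 i)
  · have hcont : Continuous fun g : C(Config d, ℝ) => S.op t (g * g) σ - S.op t g σ ^ 2 :=
      ((ContinuousMap.evalCLM (M := ℝ) ℝ σ).continuous.comp
        ((S.op t).continuous.comp (continuous_id.mul continuous_id))).sub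
        (((ContinuousMap.evalCLM (M := ℝ) ℝ σ).continuous.comp (S.op t).continuous).pow 2)
    exact le_of_tendsto ((hcont.tendsto f).comp (tendsto_truncate f))
      (Eventually.of_forall fun Λ => (htrunc Λ).2 σ)

theorem integral_sub_integral_sq (μ : Measure (Config d)) [IsProbabilityMeasure μ]
    (f : C(Config d, ℝ)) :
    ∫ σ, (f σ - ∫ η, f η ∂μ) ^ 2 ∂μ = ∫ σ, (f * f) σ ∂μ - (∫ σ, f σ ∂μ) ^ 2 := by
  set m := ∫ σ, f σ ∂μ with hm
  have h1 : ∀ σ, (f σ - m) ^ 2 = (f * f) σ - (2 * m) * f σ + m ^ 2 := fun σ => by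
    rw [ContinuousMap.mul_apply]; ring
  have hf : Integrable (fun σ => 2 * m * f σ) μ :=
    (FellerSemigroup.integrable_continuousMap μ f).const_mul _
  have hff := FellerSemigroup.integrable_continuousMap μ (f * f)
  simp_rw [h1]
  have hsub : Integrable (fun σ => (f * f) σ - 2 * m * f σ) μ := hff.sub hf
  rw [integral_add hsub (integrable_const _), integral_sub hff hf, integral_const_mul, ← hm]
  simp
  ring

theorem gradNorm_sq (f : C(Config d, ℝ)) : gradNorm f ^ 2 = ∑' i, osc f i ^ 2 :=
  Real.sq_sqrt (tsum_nonneg fun _ => sq_nonneg _)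

theorem UniformVarianceBound.evolve {c : Site d → C(Config d, ℝ)} {K M C : ℝ}
    (hc : ∀ i σ, 0 ≤ c i σ) (hK : ∀ i σ, c i σ ≤ K)
    (hM : ∀ i, Summable (dependence c i) ∧ ∑' j, dependence c i j ≤ M)
    {S : FellerSemigroup (Config d)} (hS : IsSpinFlipSemigroup c S)
    {T : lp (fun _ : Site d => ℝ) 2 →L[ℝ] lp (fun _ : Site d => ℝ) 2}
    (hT : ∀ v i, HasSum (fun j => dependence c j i * v j) (T v i))
    {μ : Measure (Config d)} [IsProbabilityMeasure μ] (hμ : UniformVarianceBound μ C)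
    (hC : 0 ≤ C) (t : ℝ≥0) :
    UniformVarianceBound (S.evolve t μ) ((K * t + C) * ‖expOp T t‖ ^ 2) := fun f hf => by
  have hK0 : 0 ≤ K := (hc 0 1).trans (hK 0 1)
  let v : lp (fun _ : Site d => ℝ) 2 := ⟨osc f, memℓp_gen (by simpa [FiniteGradNorm] using hf)⟩
  obtain ⟨hosc, hsq⟩ := semigroup_estimates hc hK hM hS hT t (v := v) (f := f) fun _ => le_rfl
  set w := expOp T t v with hw
  have hvnorm : gradNorm f ^ 2 = ‖v‖ ^ 2 := by
    rw [gradNorm_sq]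
    exact (lp_two_norm_sq v).tsum_eq
  have hwnorm : ‖w‖ ^ 2 ≤ ‖expOp T t‖ ^ 2 * gradNorm f ^ 2 := by
    rw [hvnorm, ← mul_pow]
    exact pow_le_pow_left₀ (norm_nonneg _) ((expOp T t).le_opNorm v) 2
  have hsqle : ∀ i, osc (S.op t f) i ^ 2 ≤ w i ^ 2 := fun i =>
    pow_le_pow_left₀ (osc_nonneg _ _) (hosc i) 2
  have hfin : FiniteGradNorm (S.op t f) :=
    (lp_two_norm_sq w).summable.of_nonneg_of_le (fun _ => sq_nonneg _) hsqle
  have hgrad : gradNorm (S.op t f) ^ 2 ≤ ‖w‖ ^ 2 := by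
    rw [gradNorm_sq]
    exact hasSum_le hsqle hfin.hasSum (lp_two_norm_sq w)
  have hvar := hμ (S.op t f) hfin
  rw [integral_sub_integral_sq] at hvar ⊢
  rw [S.integral_evolve, S.integral_evolve]
  have hint := FellerSemigroup.integrable_continuousMap μ
  -- This is the variance created by the dynamics; `hvar` handles the variance inherited from `μ`.
  have hlocal : ∫ σ, S.op t (f * f) σ ∂μ - ∫ σ, (S.op t f * S.op t f) σ ∂μ ≤
      K * ‖w‖ ^ 2 * t := by
    rw [← integral_sub (hint _) (hint _)]
    refine (integral_mono ((hint _).sub (hint _)) (integrable_const (K * ‖w‖ ^ 2 * t))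
      fun σ => ?_).trans (by simp)
    have h := hsq σ
    rw [sq (S.op t f σ)] at h
    exact h
  have h1 : C * gradNorm (S.op t f) ^ 2 ≤ C * ‖w‖ ^ 2 := mul_le_mul_of_nonneg_left hgrad hC
  have h2 : (K * t + C) * ‖w‖ ^ 2 ≤ (K * t + C) * (‖expOp T t‖ ^ 2 * gradNorm f ^ 2) :=
    mul_le_mul_of_nonneg_left hwnorm (add_nonneg (mul_nonneg hK0 t.2) hC)
  linarith

theorem UniformVarianceBound.mono {μ : Measure (Config d)} {C C' : ℝ}
    (h : UniformVarianceBound μ C) (hC : C ≤ C') : UniformVarianceBound μ C' := fun f hf =>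
  (h f hf).trans (mul_le_mul_of_nonneg_right hC (sq_nonneg _))

end SpinFlip

end

theorem mainTheorem4 {d : ℕ}
    (c : SpinFlip.Site d → C(SpinFlip.Config d, ℝ))
    (hA : SpinFlip.ConditionA c)
    (hbdd : SpinFlip.BoundedRates c)
    (hΓ : SpinFlip.DependenceBoundedL2 c)
    (S : SpinFlip.FellerSemigroup (SpinFlip.Config d))
    (hS : SpinFlip.IsSpinFlipSemigroup c S)
    (μ : MeasureTheory.Measure (SpinFlip.Config d)) [MeasureTheory.IsProbabilityMeasure μ]
    (hμ : ∃ C : ℝ, SpinFlip.UniformVarianceBound μ C) :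
    ∀ t : ℝ≥0, 0 < t → ∃ C : ℝ, 0 < C ∧ SpinFlip.UniformVarianceBound (S.evolve t μ) C := by
  intro t _
  obtain ⟨ε, hε, hpos⟩ := hA.positive
  obtain ⟨M, hM⟩ := hA.locality
  obtain ⟨K, hK⟩ := hbdd
  obtain ⟨T, hT⟩ := SpinFlip.exists_transpose_dependence_l2 hΓ
  obtain ⟨C, hC⟩ := hμ
  -- The given constant may be negative; it is raised to `max C 0` here, and the final one to at
  -- least `1` for strict positivity.
  have h := (hC.mono (le_max_left C 0)).evolve (fun i σ => hε.le.trans (hpos i σ)) hK hM hS hT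
    (le_max_right C 0) t
  exact ⟨_, lt_max_of_lt_right one_pos, h.mono (le_max_left _ 1)⟩
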